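/- For a finite simple graph $G$ with $v(G)$ vertices and $e(G)$ edges, a perfect matching of $G$ is a set $M\subseteq E(G)$ such that every vertex is incident with exactly one edge of $M$. An anti-forcing set of $M$ is a set $S\subseteq E(G)\setminus M$ such that $M$ is the unique perfect matching of $G-S$; $af(G,M)$ denotes the least cardinality of an anti-forcing set of $M$, and $Af(G)$ the maximum of $af(G,M)$ over all perfect matchings $M$ of $G$. In general $af(G,M)\le Af(G)\le \frac{2e(G)-v(G)}{4}$; a perfect matching $M$ is called nice if both are equalities, i.e. $af(G,M)=Af(G)=\frac{2e(G)-v(G)}{4}$. Let $\Phi^*(G)$ be the number of nice perfect matchings of $G$. For $0\le k\le n-1$, the enhanced hypercube $Q_{n,k}$ is the simple graph on $\{0,1\}^n$ in which two distinct vertices are adjacent if and only if they differ in exactly one coordinate, or one is obtained from the other by complementing the first $n-k$ coordinates, that is, $x_1\cdots x_n$ is joined to $\bar x_1\cdots\bar x_{n-k}x_{n-k+1}\cdots x_n$, where $\bar x_i=1-x_i$. Then: - $\Phi^*(Q_{n,n-1})=n$ for all $n\ge 1$; - $\Phi^*(Q_{n,n-2})=n+1$ for all $n\ge 2$; - $\Phi^*(Q_{n,n-3})=n+21$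 for all $n\ge 3$; - $\Phi^*(Q_{n,k})=n+1$ for all $n\ge 4$ and $0\le k\le n-4$. -/

import Mathlib

namespace NiceMatching

/-- The perfect matchings of `G`, as sets of edges. -/
def perfectMatchings {V : Type*} (G : SimpleGraph V) : Set (Set (Sym2 V)) :=
  {M | ∃ P : G.Subgraph, P.IsPerfectMatching ∧ P.edgeSet = M}

/-- A perfect matching is a set of edges such that each vertex is incident with exactly one of
them. -/
theorem mem_perfectMatchings_iff {V : Type*} (G : SimpleGraph V) (M : Set (Sym2 V)) :
    M ∈ perfectMatchings G ↔ M ⊆ G.edgeSet ∧ ∀ v : V, ∃! e : Sym2 V, e ∈ M ∧ v ∈ e := by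
  constructor
  · rintro ⟨P, hP, rfl⟩
    refine ⟨P.edgeSet_subset, fun v => ?_⟩
    obtain ⟨w, hw, huniq⟩ := hP.1 (hP.2 v)
    refine ⟨s(v, w), ⟨hw, Sym2.mem_mk_left v w⟩, ?_⟩
    rintro e ⟨he, hve⟩
    obtain ⟨u, rfl⟩ := hve
    rw [huniq u he]
  · rintro ⟨hsub, huniq⟩
    refine ⟨{ verts := Set.univ
              Adj := fun u w => s(u, w) ∈ M
              adj_sub := fun h => hsub h
              edge_vert := fun _ => Set.mem_univ _
              symm := ⟨fun u w h => by rwa [Sym2.eq_swap]⟩ }, ⟨?_, fun v => Set.mem_univ v⟩, ?_⟩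
    · intro v _
      obtain ⟨e, ⟨he, hve⟩, hu⟩ := huniq v
      obtain ⟨w, rfl⟩ := hve
      refine ⟨w, he, fun u hu' => ?_⟩
      exact Sym2.congr_right.mp (hu s(v, u) ⟨hu', Sym2.mem_mk_left v u⟩)
    · ext e
      induction e with
      | _ u w => rfl

/-- `S` is an anti-forcing set of the perfect matching `M` of `G`: it is a set of edges outside
`M`, and `M` is the unique perfect matching of `G - S`. -/
def IsAntiForcingSet {V : Type*} (G : SimpleGraph V) (M S : Set (Sym2 V)) : Prop :=
  S ⊆ G.edgeSet \ M ∧ perfectMatchings (G.deleteEdges S) = {M}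

/-- The anti-forcing number `af(G, M)`: the least cardinality of an anti-forcing set of `M`. -/
noncomputable def antiForcingNumber {V : Type*} (G : SimpleGraph V) (M : Set (Sym2 V)) : ℕ :=
  sInf {m : ℕ | ∃ S : Set (Sym2 V), IsAntiForcingSet G M S ∧ S.ncard = m}

/-- The maximum anti-forcing number `Af(G)`: the maximum of `af(G, M)` over all perfect
matchings `M` of `G`. -/
noncomputable def maxAntiForcingNumber {V : Type*} (G : SimpleGraph V) : ℕ :=
  sSup {m : ℕ | ∃ M ∈ perfectMatchings G, antiForcingNumber G M = m}

/-- A perfect matching `M` of `G` is nice if both inequalities in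
`af(G, M) ≤ Af(G) ≤ (2 e(G) - v(G)) / 4` are equalities. -/
def IsNice {V : Type*} (G : SimpleGraph V) (M : Set (Sym2 V)) : Prop :=
  M ∈ perfectMatchings G ∧
    antiForcingNumber G M = maxAntiForcingNumber G ∧
    (maxAntiForcingNumber G : ℚ) = (2 * (G.edgeSet.ncard : ℚ) - (Nat.card V : ℚ)) / 4

/-- `Φ*(G)`: the number of nice perfect matchings of the finite graph `G`. -/
noncomputable def numNice {V : Type*} [Finite V] (G : SimpleGraph V) : ℕ :=
  {M : Set (Sym2 V) | IsNice G M}.ncard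

/-- The hypercube `Q_n` on 0-1 sequences of length `n`: two sequences are adjacent if they differ
in exactly one position. -/
def hypercube (n : ℕ) : SimpleGraph (Fin n → Bool) where
  Adj x y := ∃! i : Fin n, x i ≠ y i
  symm := ⟨by
    rintro x y ⟨i, hi, hu⟩
    exact ⟨i, hi.symm, fun j hj => hu j hj.symm⟩⟩
  loopless := ⟨by
    rintro x ⟨i, hi, _⟩
    exact hi rfl⟩

/-- Complement the first `n - k` bits of a sequence of length `n`. -/
def complPrefix (n k : ℕ) (x : Fin n → Bool) : Fin n → Bool :=
  fun i => if (i : ℕ) < n - k then !(x i) else x i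

/-- The enhanced hypercube `Q_{n,k}` for `k < n`: the hypercube together with the edges joining
each `x` to the sequence obtained by complementing its first `n - k` bits. -/
def enhancedHypercube (n k : ℕ) : SimpleGraph (Fin n → Bool) :=
  hypercube n ⊔ SimpleGraph.fromRel (fun x y => y = complPrefix n k x)

end NiceMatching

namespace NiceMatching

/-! A perfect matching `M` is a fixed-point-free involution `φ` sending each vertex to a neighbour.
Rank the edges of `M`, select one end of each, and delete the edges going from selected ends to
higher rank: `M` becomes the only perfect matching. The opposite selection deletes the complementary
non-matching edges, so `af(G, M)` is at most half their number, which is `(2e - v)/4`. Equality for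
`M` forces `φ` to preserve adjacency (`adj_apply_of_two_mul_antiForcingNumber`); conversely, for
such `φ` an anti-forcing set must meet each pair `{xu, φxφu}`
(`ncard_le_two_mul_antiForcingNumber`). Hence `Φ*` counts adjacency-preserving matching involutions
(`numNice_eq`).

With `m = n - k`, the graph `Q_{n,k}` is the Cayley graph of `F₂ⁿ` on the unit vectors and the
prefix of `m` ones. The displacements `x + φ x` and `x + g + φ (x + g)` of neighbours, the direction
`g` and the direction between the images sum to zero. Four distinct directions have zero sum only if
`m = 3` (`four_directions`), so for `m ≠ 3` the displacement is constant and `φ` is a translation by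
a direction. For `m = 3` the directions supported on the first three coordinates are all the
odd-weight vectors there, which adds the `4! = 24` involutions exchanging the two parity classes; `n
- 3` other translations remain. -/

/-! ### Perfect matchings as involutions -/

/-- The involutions of the vertices that move each vertex to a neighbour and preserve adjacency. -/
def niceInvolutions {V : Type*} (G : SimpleGraph V) : Set (V → V) :=
  {φ | Function.Involutive φ ∧ (∀ x, G.Adj x (φ x)) ∧ ∀ x y, G.Adj x y → G.Adj (φ x) (φ y)}

/-- The edges joining each vertex to its image under `φ`. -/
def edgesOf {V : Type*} (φ : V → V) : Set (Sym2 V) := Set.range fun x => s(x, φ x)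

theorem mk_mem_edgesOf {V : Type*} {φ : V → V} (hφ : Function.Involutive φ) (x y : V) :
    s(x, y) ∈ edgesOf φ ↔ y = φ x := by
  constructor
  · rintro ⟨z, hz⟩
    rcases Sym2.eq_iff.mp hz with ⟨rfl, rfl⟩ | ⟨rfl, rfl⟩
    · rfl
    · exact (hφ z).symm
  · rintro rfl
    exact ⟨x, rfl⟩

theorem edgesOf_injOn {V : Type*} :
    Set.InjOn (edgesOf (V := V)) {φ | Function.Involutive φ} := by
  intro φ hφ ψ hψ h
  funext x
  have : s(x, φ x) ∈ edgesOf ψ := h ▸ ⟨x, rfl⟩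
  exact (mk_mem_edgesOf hψ _ _).mp this

theorem mem_perfectMatchings_iff_exists {V : Type*} (G : SimpleGraph V) (M : Set (Sym2 V)) :
    M ∈ perfectMatchings G ↔
      ∃ φ : V → V, Function.Involutive φ ∧ (∀ x, G.Adj x (φ x)) ∧ edgesOf φ = M := by
  rw [mem_perfectMatchings_iff]
  constructor
  · rintro ⟨hM, hu⟩
    have h : ∀ v, ∃ w, s(v, w) ∈ M := by
      intro v
      obtain ⟨e, ⟨he, w, rfl⟩, -⟩ := hu v
      exact ⟨w, he⟩
    choose φ hφ using h
    have key : ∀ v w, s(v, w) ∈ M → w = φ v := fun v w hw =>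
      Sym2.congr_right.mp
        ((hu v).unique ⟨hw, Sym2.mem_mk_left v w⟩ ⟨hφ v, Sym2.mem_mk_left v _⟩)
    have hinv : Function.Involutive φ := fun v =>
      (key (φ v) v (by rw [Sym2.eq_swap]; exact hφ v)).symm
    refine ⟨φ, hinv, fun x => hM (hφ x), ?_⟩
    ext e
    induction e with
    | _ u w =>
      rw [mk_mem_edgesOf hinv]
      exact ⟨fun h => h ▸ hφ u, key u w⟩
  · rintro ⟨φ, hφ, hadj, rfl⟩
    refine ⟨?_, fun v => ⟨s(v, φ v), ⟨⟨v, rfl⟩, Sym2.mem_mk_left _ _⟩, ?_⟩⟩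
    · rintro _ ⟨x, rfl⟩
      exact hadj x
    · rintro e ⟨he, w, rfl⟩
      rw [(mk_mem_edgesOf hφ _ _).mp he]

/-- Degree sums before and after deleting the matching differ by one at each vertex. -/
theorem two_mul_ncard_diff_edgesOf {V : Type*} [Finite V] {G : SimpleGraph V} {φ : V → V}
    (hφ : Function.Involutive φ) (hadj : ∀ x, G.Adj x (φ x)) :
    2 * (G.edgeSet \ edgesOf φ).ncard + Nat.card V = 2 * G.edgeSet.ncard := by
  classical
  have := Fintype.ofFinite V
  have h1 := G.sum_degrees_eq_twice_card_edges
  have h2 := (G.deleteEdges (edgesOf φ)).sum_degrees_eq_twice_card_edges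
  rw [← Set.ncard_coe_finset, SimpleGraph.coe_edgeFinset] at h1 h2
  rw [SimpleGraph.edgeSet_deleteEdges] at h2
  rw [← h1, ← h2, Nat.card_eq_fintype_card, Fintype.card_eq_sum_ones, ← Finset.sum_add_distrib]
  refine Finset.sum_congr rfl fun x _ => ?_
  rw [← SimpleGraph.card_neighborFinset_eq_degree, ← SimpleGraph.card_neighborFinset_eq_degree]
  have : (G.deleteEdges (edgesOf φ)).neighborFinset x = (G.neighborFinset x).erase (φ x) := by
    ext y
    simp [SimpleGraph.deleteEdges_adj, mk_mem_edgesOf hφ, and_comm]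
  rw [this, Finset.card_erase_add_one]
  simpa using hadj x

/-! ### Anti-forcing sets from rankings: the upper bound -/

/-- The edges joining a vertex selected by `c` to a vertex of larger rank. -/
def upEdges {V : Type*} (G : SimpleGraph V) (r : V → ℕ) (c : V → Bool) : Set (Sym2 V) :=
  {e | ∃ a b, s(a, b) = e ∧ G.Adj a b ∧ r a < r b ∧ c a = true}

/-- `r` ranks the edges of the matching given by `φ`. -/
def IsRanking {V : Type*} (φ : V → V) (r : V → ℕ) : Prop :=
  ∀ a b, r a = r b ↔ b = a ∨ b = φ a

theorem IsRanking.apply {V : Type*} {φ : V → V} {r : V → ℕ} (hr : IsRanking φ r) (a : V) :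
    r (φ a) = r a := ((hr _ _).mpr (Or.inr rfl)).symm

theorem upEdges_subset {V : Type*} {G : SimpleGraph V} {φ : V → V} {r : V → ℕ} (c : V → Bool)
    (hφ : Function.Involutive φ) (hr : IsRanking φ r) :
    upEdges G r c ⊆ G.edgeSet \ edgesOf φ := by
  rintro _ ⟨a, b, rfl, hab, hlt, -⟩
  refine ⟨hab, fun h => ?_⟩
  rw [mk_mem_edgesOf hφ] at h
  subst h
  rw [hr.apply] at hlt
  exact hlt.false

/-- Induction on the rank: a selected end cannot be matched upwards, where its edges are deleted,
nor downwards, where all vertices are already matched by `φ`. So it keeps its partner. -/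
theorem isAntiForcingSet_upEdges {V : Type*} {G : SimpleGraph V} {φ : V → V} {r : V → ℕ}
    {c : V → Bool} (hφ : Function.Involutive φ) (hadj : ∀ x, G.Adj x (φ x))
    (hr : IsRanking φ r) (hc : ∀ a, c (φ a) = !c a) :
    IsAntiForcingSet G (edgesOf φ) (upEdges G r c) := by
  have hsub := upEdges_subset (G := G) c hφ hr
  refine ⟨hsub, Set.eq_singleton_iff_unique_mem.mpr ⟨?_, ?_⟩⟩
  · rw [mem_perfectMatchings_iff_exists]
    refine ⟨φ, hφ, fun x => ?_, rfl⟩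
    rw [SimpleGraph.deleteEdges_adj]
    exact ⟨hadj x, fun h => (hsub h).2 ⟨x, rfl⟩⟩
  · intro M hM
    obtain ⟨ψ, hψ, hadjψ, rfl⟩ := (mem_perfectMatchings_iff_exists _ _).mp hM
    have main : ∀ m a, r a = m → ψ a = φ a := by
      intro m
      induction m using Nat.strong_induction_on with
      | _ m ih =>
        have sel : ∀ a, r a = m → c a = true → ψ a = φ a := by
          intro a ha hca
          have h1 : ¬ r (ψ a) < r a := by
            intro hlt
            have h2 := ih _ (ha ▸ hlt) (ψ a) rfl
            rw [hψ a] at h2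
            have h5 := hr.apply (ψ a)
            rw [← h2] at h5
            omega
          have h3 : ¬ r a < r (ψ a) := by
            intro hlt
            have h4 := hadjψ a
            rw [SimpleGraph.deleteEdges_adj] at h4
            exact h4.2 ⟨a, ψ a, rfl, h4.1, hlt, hca⟩
          rcases (hr a (ψ a)).mp (by omega) with h | h
          · exact absurd h (hadjψ a).ne'
          · exact h
        intro a ha
        cases hca : c a with
        | true => exact sel a ha hca
        | false =>
          have := sel (φ a) (by rw [hr.apply, ha]) (by rw [hc, hca]; rfl)
          rw [hφ a] at this
          rw [← this, hψ, this]
    rw [show ψ = φ from funext fun a => main _ a rfl]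

theorem ncard_upEdges_add {V : Type*} [Finite V] {G : SimpleGraph V} {φ : V → V} {r : V → ℕ}
    (c : V → Bool) (hφ : Function.Involutive φ) (hr : IsRanking φ r) :
    (upEdges G r c).ncard + (upEdges G r fun a => !c a).ncard =
      (G.edgeSet \ edgesOf φ).ncard := by
  rw [← Set.ncard_union_eq]
  · congr 1
    apply Set.Subset.antisymm
    · exact Set.union_subset (upEdges_subset _ hφ hr) (upEdges_subset _ hφ hr)
    · intro e
      induction e with
      | _ a b =>
        rintro ⟨hab, hne⟩
        rw [mk_mem_edgesOf hφ] at hne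
        have hab : G.Adj a b := hab
        have hrab : r a ≠ r b := fun h => by
          rcases (hr a b).mp h with h | h
          · exact hab.ne' h
          · exact hne h
        rcases hrab.lt_or_gt with h | h
        · cases hc : c a
          · exact Or.inr ⟨a, b, rfl, hab, h, by simp [hc]⟩
          · exact Or.inl ⟨a, b, rfl, hab, h, hc⟩
        · cases hc : c b
          · exact Or.inr ⟨b, a, Sym2.eq_swap, hab.symm, h, by simp [hc]⟩
          · exact Or.inl ⟨b, a, Sym2.eq_swap, hab.symm, h, hc⟩
  · rw [Set.disjoint_left]
    rintro _ ⟨a, b, rfl, -, hlt, hc⟩ ⟨a', b', he, -, hlt', hc'⟩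
    rcases Sym2.eq_iff.mp he with ⟨rfl, rfl⟩ | ⟨rfl, rfl⟩
    · simp [hc] at hc'
    · omega

theorem ncard_upEdges {V : Type*} [Fintype V] (G : SimpleGraph V) (r : V → ℕ) (c : V → Bool) :
    (upEdges G r c).ncard = ∑ a, if c a = true then {b | G.Adj a b ∧ r a < r b}.ncard else 0 := by
  classical
  have h : upEdges G r c = ((Finset.univ.filter fun p : V × V =>
      G.Adj p.1 p.2 ∧ r p.1 < r p.2 ∧ c p.1 = true).image fun p => s(p.1, p.2) : Finset _) := by
    ext e
    simp only [upEdges, Set.mem_ofPred_eq, Finset.coe_image, Finset.coe_filter, Finset.mem_univ,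
      true_and, Set.mem_image, Prod.exists]
    exact ⟨fun ⟨a, b, h, h'⟩ => ⟨a, b, h', h⟩, fun ⟨a, b, h, h'⟩ => ⟨a, b, h', h⟩⟩
  rw [h, Set.ncard_coe_finset, Finset.card_image_of_injOn]
  · rw [Finset.card_filter, Fintype.sum_prod_type]
    refine Finset.sum_congr rfl fun a _ => ?_
    split_ifs with hc
    · rw [← Finset.card_filter, ← Set.ncard_coe_finset]
      simp [hc]
    · simp [hc]
  · rintro ⟨a, b⟩ h ⟨a', b'⟩ h' he
    simp only [Finset.coe_filter, Finset.mem_univ, true_and, Set.mem_ofPred_eq] at h h'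
    rcases Sym2.eq_iff.mp he with ⟨rfl, rfl⟩ | ⟨rfl, rfl⟩
    · rfl
    · exact absurd h.2.1 h'.2.1.le.not_gt

theorem antiForcingNumber_le {V : Type*} {G : SimpleGraph V} {M S : Set (Sym2 V)}
    (h : IsAntiForcingSet G M S) : antiForcingNumber G M ≤ S.ncard :=
  Nat.sInf_le ⟨S, h, rfl⟩

theorem exists_selection {V : Type*} [Finite V] {φ : V → V} (hφ : Function.Involutive φ)
    (hne : ∀ x, φ x ≠ x) : ∃ c : V → Bool, ∀ a, c (φ a) = !c a := by
  obtain ⟨N, ⟨ι⟩⟩ := Finite.exists_equiv_fin V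
  refine ⟨fun a => decide (ι a < ι (φ a)), fun a => ?_⟩
  have : ι (φ a) ≠ ι a := fun h => hne a (ι.injective h)
  simp only [hφ a, ← decide_not, decide_eq_decide]
  omega

theorem exists_ranking {V : Type*} [Finite V] {φ : V → V} (hφ : Function.Involutive φ) :
    ∃ r, IsRanking φ r := by
  obtain ⟨N, ⟨ι⟩⟩ := Finite.exists_equiv_fin V
  refine ⟨fun a => min (ι a) (ι (φ a)), fun a b => ⟨fun h => ?_, ?_⟩⟩
  · have e : ∀ x y, (ι x : ℕ) = ι y → x = y := fun x y h => ι.injective (Fin.ext h)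
    have : (ι a : ℕ) = ι b ∨ (ι a : ℕ) = ι (φ b) ∨ (ι (φ a) : ℕ) = ι b ∨
        (ι (φ a) : ℕ) = ι (φ b) := by
      simp only at h
      omega
    rcases this with h | h | h | h
    · exact Or.inl (e _ _ h).symm
    · right
      rw [e _ _ h, hφ b]
    · exact Or.inr (e _ _ h).symm
    · exact Or.inl (hφ.injective (e _ _ h)).symm
  · rintro (rfl | rfl)
    · rfl
    · simp only [hφ a]
      exact min_comm _ _

/-- Any two edges of the matching can be ranked last. -/
theorem exists_ranking_last {V : Type*} [Finite V] {φ : V → V} (hφ : Function.Involutive φ)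
    {x u : V} (h1 : u ≠ x) (h2 : u ≠ φ x) :
    ∃ r, IsRanking φ r ∧ ∀ b, r x < r b ↔ b = u ∨ b = φ u := by
  classical
  obtain ⟨r, hr⟩ := exists_ranking hφ
  obtain ⟨N, hN⟩ : ∃ N, ∀ a, r a < N := by
    obtain ⟨N, hN⟩ := (Set.finite_range r).bddAbove
    exact ⟨N + 1, fun a => Nat.lt_succ_of_le (hN ⟨a, rfl⟩)⟩
  refine ⟨fun a => if r a = r u then N + 1 else if r a = r x then N else r a, ?_, ?_⟩
  · intro a b
    rw [← hr a b]
    have := hN a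
    have := hN b
    simp only
    split_ifs <;> omega
  · intro b
    rw [← hr u b]
    have hxu : r x ≠ r u := fun h => by
      rcases (hr _ _).mp h with h | h
      · exact h1 h
      · exact h2 h
    have := hN b
    simp only [hxu, if_false, if_true]
    split_ifs <;> omega

theorem two_mul_antiForcingNumber_le {V : Type*} [Finite V] {G : SimpleGraph V} {φ : V → V}
    (hφ : Function.Involutive φ) (hadj : ∀ x, G.Adj x (φ x)) :
    2 * antiForcingNumber G (edgesOf φ) ≤ (G.edgeSet \ edgesOf φ).ncard := by
  obtain ⟨r, hr⟩ := exists_ranking hφ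
  obtain ⟨c, hc⟩ := exists_selection hφ fun x => (hadj x).ne'
  have h1 := antiForcingNumber_le (isAntiForcingSet_upEdges hφ hadj hr hc)
  have h2 := antiForcingNumber_le
    (isAntiForcingSet_upEdges (c := fun a => !c a) hφ hadj hr fun a => by simp [hc])
  have h3 := ncard_upEdges_add (G := G) c hφ hr
  omega

/-! ### The equality case: adjacency is preserved -/

/-- A selection and its opposite both give anti-forcing sets, and their sizes sum to twice the
minimum. Hence every selection attains the minimum, and reversing it on the one edge `x, φ x`
changes nothing. -/
theorem ncard_up_eq {V : Type*} [Finite V] {G : SimpleGraph V} {φ : V → V}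
    (hφ : Function.Involutive φ) (hadj : ∀ x, G.Adj x (φ x))
    (haf : 2 * antiForcingNumber G (edgesOf φ) = (G.edgeSet \ edgesOf φ).ncard)
    {r : V → ℕ} (hr : IsRanking φ r) (x : V) :
    {b | G.Adj x b ∧ r x < r b}.ncard = {b | G.Adj (φ x) b ∧ r (φ x) < r b}.ncard := by
  classical
  have := Fintype.ofFinite V
  have key : ∀ c : V → Bool, (∀ a, c (φ a) = !c a) →
      (upEdges G r c).ncard = antiForcingNumber G (edgesOf φ) := by
    intro c hc
    have h1 := antiForcingNumber_le (isAntiForcingSet_upEdges hφ hadj hr hc)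
    have h2 := antiForcingNumber_le
      (isAntiForcingSet_upEdges (c := fun a => !c a) hφ hadj hr fun a => by simp [hc])
    have h3 := ncard_upEdges_add (G := G) c hφ hr
    omega
  obtain ⟨c, hc⟩ := exists_selection hφ fun x => (hadj x).ne'
  have hne : x ≠ φ x := (hadj x).ne
  have h0 := key c hc
  have h1 := key (fun a => if a ∈ ({x, φ x} : Finset V) then !c a else c a) (by
    intro a
    have : φ a ∈ ({x, φ x} : Finset V) ↔ a ∈ ({x, φ x} : Finset V) := by
      simp only [Finset.mem_insert, Finset.mem_singleton, hφ.injective.eq_iff]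
      rw [hφ.eq_iff, or_comm]
    simp only [this, hc]
    split_ifs <;> rfl)
  rw [← h0, ncard_upEdges, ncard_upEdges, ← Finset.sum_add_sum_compl {x, φ x},
    ← Finset.sum_add_sum_compl {x, φ x} (fun a => if c a = true then _ else 0)] at h1
  rw [Finset.sum_congr (s₁ := {x, φ x}ᶜ) rfl (fun a ha => by
    rw [if_neg (Finset.mem_compl.mp ha)]), Nat.add_right_cancel_iff, Finset.sum_pair hne,
    Finset.sum_pair hne] at h1
  have hcx := hc x
  cases hb : c x <;> simp [hcx, hb] at h1
  · exact h1
  · exact h1.symm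

theorem ncard_adj_pair {V : Type*} (G : SimpleGraph V) [DecidableRel G.Adj] {x u w : V}
    (h : u ≠ w) : {b | G.Adj x b ∧ (b = u ∨ b = w)}.ncard =
      (if G.Adj x u then 1 else 0) + if G.Adj x w then 1 else 0 := by
  have : {b | G.Adj x b ∧ (b = u ∨ b = w)} =
      (if G.Adj x u then {u} else ∅) ∪ if G.Adj x w then {w} else ∅ := by
    ext b
    simp only [Set.mem_ofPred_eq, Set.mem_union]
    constructor
    · rintro ⟨hb, rfl | rfl⟩ <;> simp [hb]
    · split_ifs <;> simp <;> rintro (rfl | rfl) <;> simp [*]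
  rw [this]
  split_ifs <;> simp [Set.ncard_pair h.symm]

theorem adj_apply_of_two_mul_antiForcingNumber {V : Type*} [Finite V] {G : SimpleGraph V}
    {φ : V → V} (hφ : Function.Involutive φ) (hadj : ∀ x, G.Adj x (φ x))
    (haf : 2 * antiForcingNumber G (edgesOf φ) = (G.edgeSet \ edgesOf φ).ncard)
    {x u : V} (hxu : G.Adj x u) : G.Adj (φ x) (φ u) := by
  classical
  by_cases hu : u = φ x
  · subst hu
    rw [hφ x]
    exact hxu.symm
  have count : ∀ x u : V, u ≠ x → u ≠ φ x →
      ((if G.Adj x u then 1 else 0) + if G.Adj x (φ u) then 1 else 0) =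
      (if G.Adj (φ x) u then 1 else 0) + if G.Adj (φ x) (φ u) then 1 else 0 := by
    intro x u h1 h2
    obtain ⟨r, hr, hlast⟩ := exists_ranking_last hφ h1 h2
    have h := ncard_up_eq hφ hadj haf hr x
    rw [hr.apply] at h
    simp only [hlast] at h
    rwa [ncard_adj_pair G (hadj u).ne, ncard_adj_pair G (hadj u).ne] at h
  -- If `φ x` and `φ u` were not adjacent, these two counts would read `1 + p = q` and `1 + q = p`,
  -- where `p` and `q` are the indicators of the adjacencies `x, φ u` and `φ x, u`.
  have h1 := count x u hxu.ne' hu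
  have h2 := count u x hxu.ne fun h => hu (by rw [h, hφ u])
  simp only [G.adj_comm u, G.adj_comm (φ u), hxu, if_true] at h1 h2
  by_contra hcon
  simp only [hcon, if_false] at h1 h2
  split_ifs at h1 h2 <;> omega

/-! ### The converse and the characterization of nice matchings -/

/-- Otherwise the matching could be switched along the alternating cycle through `x`, `u`,
`φ u` and `φ x`. -/
theorem eq_apply_of_unique {V : Type*} {G : SimpleGraph V} {φ : V → V} {S : Set (Sym2 V)}
    (hφ : Function.Involutive φ) (hadj : ∀ x, G.Adj x (φ x)) (hS : S ⊆ G.edgeSet \ edgesOf φ)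
    (huniq : perfectMatchings (G.deleteEdges S) = {edgesOf φ}) {x u : V} (hxu : G.Adj x u)
    (hφxu : G.Adj (φ x) (φ u)) (h1 : s(x, u) ∉ S) (h2 : s(φ x, φ u) ∉ S) : u = φ x := by
  classical
  by_contra hne
  have hne' : x ≠ φ u := fun h => hne (by rw [h, hφ u])
  have d1 := hxu.ne
  have d2 := (hadj x).ne
  have d3 := (hadj u).ne
  have d4 := hφxu.ne
  have hh : ∀ a b, φ a = b ↔ a = φ b := fun a b => hφ.eq_iff
  let ψ : V → V := fun a =>
    if a = x then u else if a = u then x else if a = φ x then φ u else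
      if a = φ u then φ x else φ a
  have e1 : ψ x = u := by simp [ψ]
  have e2 : ψ u = x := by simp [ψ, d1.symm]
  have e3 : ψ (φ x) = φ u := by simp [ψ, d2.symm, Ne.symm hne]
  have e4 : ψ (φ u) = φ x := by simp [ψ, d3.symm, hne'.symm, d4.symm]
  have e5 : ∀ a, a ≠ x → a ≠ u → a ≠ φ x → a ≠ φ u → ψ a = φ a := by
    intro a h1 h2 h3 h4
    simp [ψ, h1, h2, h3, h4]
  have cases4 : ∀ p : V → Prop, p x → p u → p (φ x) → p (φ u) →
      (∀ a, a ≠ x → a ≠ u → a ≠ φ x → a ≠ φ u → p a) → ∀ a, p a := by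
    intro p p1 p2 p3 p4 p5 a
    by_cases c1 : a = x
    · exact c1 ▸ p1
    by_cases c2 : a = u
    · exact c2 ▸ p2
    by_cases c3 : a = φ x
    · exact c3 ▸ p3
    by_cases c4 : a = φ u
    · exact c4 ▸ p4
    exact p5 a c1 c2 c3 c4
  have hψ : Function.Involutive ψ := by
    refine cases4 _ ?_ ?_ ?_ ?_ ?_
    · rw [e1, e2]
    · rw [e2, e1]
    · rw [e3, e4]
    · rw [e4, e3]
    · intro a c1 c2 c3 c4
      rw [e5 a c1 c2 c3 c4, e5, hφ a]
      · rwa [Ne, hh]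
      · rwa [Ne, hh]
      · rwa [Ne, hφ.injective.eq_iff]
      · rwa [Ne, hφ.injective.eq_iff]
  have hadjψ : ∀ a, (G.deleteEdges S).Adj a (ψ a) := by
    simp only [SimpleGraph.deleteEdges_adj]
    refine cases4 _ ?_ ?_ ?_ ?_ ?_
    · rw [e1]
      exact ⟨hxu, h1⟩
    · rw [e2, Sym2.eq_swap]
      exact ⟨hxu.symm, h1⟩
    · rw [e3]
      exact ⟨hφxu, h2⟩
    · rw [e4, Sym2.eq_swap]
      exact ⟨hφxu.symm, h2⟩
    · intro a c1 c2 c3 c4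
      rw [e5 a c1 c2 c3 c4]
      exact ⟨hadj a, fun h => (hS h).2 ⟨a, rfl⟩⟩
  have hmem : edgesOf ψ ∈ perfectMatchings (G.deleteEdges S) :=
    (mem_perfectMatchings_iff_exists _ _).mpr ⟨ψ, hψ, hadjψ, rfl⟩
  rw [huniq] at hmem
  have := edgesOf_injOn hψ hφ hmem
  exact hne (by rw [← e1, this])

theorem ncard_le_two_mul_antiForcingNumber {V : Type*} [Finite V] {G : SimpleGraph V}
    {φ : V → V} (hφ : φ ∈ niceInvolutions G) :
    (G.edgeSet \ edgesOf φ).ncard ≤ 2 * antiForcingNumber G (edgesOf φ) := by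
  obtain ⟨hinv, hadj, hpres⟩ := hφ
  -- Without this, `sInf` could be its default value `0` on the empty set.
  have hne : {m : ℕ | ∃ S, IsAntiForcingSet G (edgesOf φ) S ∧ S.ncard = m}.Nonempty := by
    obtain ⟨r, hr⟩ := exists_ranking hinv
    obtain ⟨c, hc⟩ := exists_selection hinv fun x => (hadj x).ne'
    exact ⟨_, _, isAntiForcingSet_upEdges hinv hadj hr hc, rfl⟩
  obtain ⟨S, ⟨hS, huniq⟩, hcard⟩ := Nat.sInf_mem hne
  rw [antiForcingNumber, ← hcard]
  -- For each non-matching edge, either it or its image under `φ` lies in `S`; thus `S` and its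
  -- image cover.
  have hcover : G.edgeSet \ edgesOf φ ⊆ S ∪ Sym2.map φ '' S := by
    intro e
    induction e with
    | _ x u =>
      rintro ⟨hxu, hM⟩
      have hxu : G.Adj x u := hxu
      by_contra hcon
      rw [mk_mem_edgesOf hinv] at hM
      have h1 : s(x, u) ∉ S := fun h => hcon (Or.inl h)
      have h2 : s(φ x, φ u) ∉ S := fun h =>
        hcon (Or.inr ⟨_, h, by rw [Sym2.map_mk]; simp [hinv x, hinv u]⟩)
      exact hM (eq_apply_of_unique hinv hadj hS huniq hxu (hpres x u hxu) h1 h2)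
  calc _ ≤ _ := Set.ncard_le_ncard hcover
    _ ≤ _ := Set.ncard_union_le _ _
    _ ≤ S.ncard + S.ncard := Nat.add_le_add_left (Set.ncard_image_le) _
    _ = _ := (two_mul _).symm

theorem isNice_iff {V : Type*} [Finite V] (G : SimpleGraph V) (M : Set (Sym2 V)) :
    IsNice G M ↔ ∃ φ ∈ niceInvolutions G, edgesOf φ = M := by
  have hbdd : ∀ m ∈ {m : ℕ | ∃ M ∈ perfectMatchings G, antiForcingNumber G M = m},
      4 * m + Nat.card V ≤ 2 * G.edgeSet.ncard := by
    rintro m ⟨M, hM, rfl⟩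
    obtain ⟨φ, hφ, hadj, rfl⟩ := (mem_perfectMatchings_iff_exists _ _).mp hM
    have := two_mul_antiForcingNumber_le hφ hadj
    have := two_mul_ncard_diff_edgesOf hφ hadj
    omega
  have hcast : ∀ m : ℕ, (m : ℚ) = (2 * (G.edgeSet.ncard : ℚ) - (Nat.card V : ℚ)) / 4 ↔
      4 * m + Nat.card V = 2 * G.edgeSet.ncard := by
    intro m
    rw [eq_div_iff (by norm_num), eq_sub_iff_add_eq, mul_comm]
    exact_mod_cast Iff.rfl
  rw [IsNice, hcast]
  constructor
  · rintro ⟨hM, h1, h2⟩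
    obtain ⟨φ, hφ, hadj, rfl⟩ := (mem_perfectMatchings_iff_exists _ _).mp hM
    have := two_mul_ncard_diff_edgesOf hφ hadj
    exact ⟨φ, ⟨hφ, hadj, fun x y => adj_apply_of_two_mul_antiForcingNumber hφ hadj
      (by omega)⟩, rfl⟩
  · rintro ⟨φ, hφ, rfl⟩
    have hM : edgesOf φ ∈ perfectMatchings G :=
      (mem_perfectMatchings_iff_exists _ _).mpr ⟨φ, hφ.1, hφ.2.1, rfl⟩
    have h1 := two_mul_ncard_diff_edgesOf hφ.1 hφ.2.1
    have h2 := ncard_le_two_mul_antiForcingNumber hφ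
    have h3 := hbdd _ ⟨_, hM, rfl⟩
    -- Boundedness makes `sSup` a genuine maximum rather than the default `0`.
    have h4 : antiForcingNumber G (edgesOf φ) ≤ maxAntiForcingNumber G :=
      le_csSup ⟨2 * G.edgeSet.ncard, fun m hm => by have := hbdd m hm; omega⟩ ⟨_, hM, rfl⟩
    have h5 := hbdd (maxAntiForcingNumber G) (Nat.sSup_mem ⟨_, _, hM, rfl⟩
      ⟨2 * G.edgeSet.ncard, fun m hm => by have := hbdd m hm; omega⟩)
    exact ⟨hM, by omega, by omega⟩

theorem numNice_eq {V : Type*} [Finite V] (G : SimpleGraph V) :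
    numNice G = (niceInvolutions G).ncard := by
  rw [numNice, ← (edgesOf_injOn.mono fun φ h => h.1).ncard_image]
  congr 1
  ext M
  exact isNice_iff G M


/-! ### Enhanced hypercubes as Cayley graphs -/

/-! Binary sequences are added modulo two. -/

/-- Multiples of this equation supply characteristic two to `linear_combination`. -/
theorem two_eq_zero {ι : Type*} : (2 : ι → Bool) = 0 := rfl

/-- The sequence starting with `m` ones and continuing with zeros. -/
def onesPrefix (n m : ℕ) : Fin n → Bool := fun i => decide ((i : ℕ) < m)

/-- The differences between adjacent vertices of an enhanced hypercube. -/
def directions (n m : ℕ) : Set (Fin n → Bool) :=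
  Set.range (fun i => Pi.single i 1) ∪ {onesPrefix n m}

theorem bool_add (a b : Bool) : a + b = xor a b := rfl

theorem add_eq_zero_iff {ι : Type*} {x y : ι → Bool} : x + y = 0 ↔ x = y := by
  constructor
  · intro h
    linear_combination h - y * two_eq_zero
  · intro h
    linear_combination h + y * two_eq_zero

theorem single_injective {n : ℕ} :
    Function.Injective (fun i : Fin n => (Pi.single i 1 : Fin n → Bool)) := by
  intro i j h
  by_contra hne
  have := congrFun h i
  simp [hne] at this

theorem onesPrefix_ne_zero {n m : ℕ} (hm : 1 ≤ m) (hn : m ≤ n) : onesPrefix n m ≠ 0 := by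
  intro h
  have := congrFun h ⟨0, by omega⟩
  simp only [onesPrefix, Pi.zero_apply] at this
  exact absurd (of_decide_eq_false this) (by simp; omega)

theorem add_eq_single_iff {n : ℕ} {x y : Fin n → Bool} {i : Fin n} :
    x + y = Pi.single i 1 ↔ ∀ j, x j ≠ y j ↔ j = i := by
  rw [funext_iff]
  refine forall_congr' fun j => ?_
  rw [Pi.add_apply, Pi.single_apply]
  split_ifs with h
  · simp only [h, iff_true]
    generalize x i = a
    generalize y i = b
    revert a b
    decide
  · simp only [h, iff_false, not_not]
    generalize x j = a
    generalize y j = b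
    revert a b
    decide

theorem complPrefix_eq (n k : ℕ) (x : Fin n → Bool) :
    complPrefix n k x = x + onesPrefix n (n - k) := by
  funext i
  rw [Pi.add_apply, complPrefix, onesPrefix]
  by_cases h : (i : ℕ) < n - k <;> simp [h, bool_add]

theorem enhancedHypercube_adj {n k : ℕ} (hk : k < n) {x y : Fin n → Bool} :
    (enhancedHypercube n k).Adj x y ↔ x + y ∈ directions n (n - k) := by
  have h0 := onesPrefix_ne_zero (n := n) (m := n - k) (by omega) (by omega)
  rw [enhancedHypercube, SimpleGraph.sup_adj, SimpleGraph.fromRel_adj, directions, Set.mem_union,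
    Set.mem_range, Set.mem_singleton_iff]
  refine or_congr ?_ ?_
  · refine exists_congr fun i => ?_
    rw [eq_comm, add_eq_single_iff]
    constructor
    · rintro ⟨h1, h2⟩ j
      exact ⟨h2 j, fun h => h ▸ h1⟩
    · intro h
      exact ⟨(h i).mpr rfl, fun j => (h j).mp⟩
  · rw [complPrefix_eq, complPrefix_eq]
    constructor
    · rintro ⟨-, h | h⟩
      · linear_combination h + x * two_eq_zero
      · linear_combination h + y * two_eq_zero
    · intro h
      refine ⟨fun e => h0 ?_, Or.inl ?_⟩
      · rw [← h, e]
        exact add_eq_zero_iff.mpr rfl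
      · linear_combination h - x * two_eq_zero

/-- The prefix of length one is itself a unit vector, so it adds no direction. -/
theorem ncard_directions_one {n : ℕ} (hn : 1 ≤ n) : (directions n 1).ncard = n := by
  have : directions n 1 = Set.range fun i : Fin n => (Pi.single i 1 : Fin n → Bool) := by
    rw [directions, Set.union_eq_left, Set.singleton_subset_iff]
    refine ⟨⟨0, by omega⟩, ?_⟩
    funext i
    simp only [Pi.single_apply, onesPrefix, Fin.ext_iff, Nat.lt_one_iff]
    split_ifs with h
    · simp [h]; rfl
    · simp [h]; rfl
  rw [this, ← Nat.card_coe_set_eq, Nat.card_range_of_injective single_injective, Nat.card_fin]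

theorem ncard_directions {n m : ℕ} (hm : 2 ≤ m) (hn : m ≤ n) :
    (directions n m).ncard = n + 1 := by
  rw [directions, Set.union_singleton, Set.ncard_insert_of_notMem, ← Nat.card_coe_set_eq,
    Nat.card_range_of_injective single_injective, Nat.card_fin]
  rintro ⟨i, hi⟩
  have h : ∀ j : Fin n, (j : ℕ) < m → j = i := by
    intro j hj
    by_contra hne
    have := congrFun hi j
    simp [onesPrefix, hne, hj] at this
  have h0 := h ⟨0, by omega⟩ (by simp; omega)
  have h1 := h ⟨1, by omega⟩ (by simp; omega)
  rw [← h1, Fin.ext_iff] at h0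
  simp at h0

/-! ### Linear relations between directions -/

/-- The sequence `v` vanishes after its first three terms. -/
def IsLow {n : ℕ} (v : Fin n → Bool) : Prop := ∀ t : Fin n, 3 ≤ (t : ℕ) → v t = 0

theorem three_singles {n m : ℕ} (hn : m ≤ n) {i j l : Fin n} (hij : i ≠ j) (hil : i ≠ l)
    (hjl : j ≠ l) (h : onesPrefix n m = Pi.single i 1 + Pi.single j 1 + Pi.single l 1) :
    m = 3 ∧ (i : ℕ) < 3 ∧ (j : ℕ) < 3 ∧ (l : ℕ) < 3 := by
  have key : ∀ t : Fin n, (t : ℕ) < m ↔ t ∈ ({i, j, l} : Finset (Fin n)) := by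
    intro t
    have := congrFun h t
    simp only [onesPrefix, Pi.add_apply, Pi.single_apply, bool_add] at this
    rw [← decide_eq_true_iff (p := (t : ℕ) < m), this]
    simp only [Finset.mem_insert, Finset.mem_singleton]
    by_cases h1 : t = i
    · subst h1
      simp [hij, hil]
      rfl
    by_cases h2 : t = j
    · subst h2
      simp [hij.symm, hjl]
      decide
    by_cases h3 : t = l
    · subst h3
      simp [hil.symm, hjl.symm]
      rfl
    simp [h1, h2, h3]
  have hcard : Fintype.card {t : Fin n // (t : ℕ) < m} = 3 := by
    rw [Fintype.card_of_subtype {i, j, l} fun t => (key t).symm]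
    exact Finset.card_eq_three.mpr ⟨i, j, l, hij, hil, hjl, rfl⟩
  have hm : m = 3 := by
    rw [← hcard, Fintype.card_congr (β := Fin m)
      ⟨fun t => ⟨t.1, t.2⟩, fun s => ⟨⟨s, s.2.trans_le hn⟩, s.2⟩, fun _ => rfl, fun _ => rfl⟩,
      Fintype.card_fin]
  subst hm
  exact ⟨rfl, (key i).mpr (by simp), (key j).mpr (by simp), (key l).mpr (by simp)⟩

theorem single_isLow {n : ℕ} {i : Fin n} (hi : (i : ℕ) < 3) :
    IsLow (Pi.single i 1 : Fin n → Bool) := by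
  intro t ht
  exact Pi.single_eq_of_ne (by rintro rfl; omega) _

theorem onesPrefix_three_isLow {n : ℕ} : IsLow (onesPrefix n 3) := by
  intro t ht
  exact decide_eq_false (by omega)

/-- Four distinct directions are linearly independent, except possibly for `m = 3`. -/
theorem four_directions {n m : ℕ} (hn : m ≤ n) {a b c d : Fin n → Bool}
    (ha : a ∈ directions n m) (hb : b ∈ directions n m) (hc : c ∈ directions n m)
    (hd : d ∈ directions n m) (hab : a ≠ b) (hac : a ≠ c) (had : a ≠ d) (hbc : b ≠ c)
    (hbd : b ≠ d) (hcd : c ≠ d) (h : a + b + c = d) :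
    m = 3 ∧ IsLow a ∧ IsLow b ∧ IsLow c := by
  -- By distinctness at most one direction is the prefix. With none, coordinate `i` gives a
  -- contradiction; with one, the prefix is a sum of three distinct unit vectors.
  rcases ha with ⟨i, rfl⟩ | rfl <;> rcases hb with ⟨j, rfl⟩ | rfl <;>
    rcases hc with ⟨l, rfl⟩ | rfl <;> rcases hd with ⟨o, rfl⟩ | rfl <;>
    first | exact absurd rfl hab | exact absurd rfl hac | exact absurd rfl had
          | exact absurd rfl hbc | exact absurd rfl hbd | exact absurd rfl hcd | skip
  · exfalso
    have e : ∀ {p q : Fin n}, (Pi.single p 1 : Fin n → Bool) ≠ Pi.single q 1 → p ≠ q :=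
      fun h e => h (by rw [e])
    have := congrFun h i
    simp [e hab, e hac, e had] at this
  · obtain ⟨hm, h1, h2, h3⟩ := three_singles hn (fun e => hab (by rw [e]))
      (fun e => hac (by rw [e])) (fun e => hbc (by rw [e])) h.symm
    exact ⟨hm, single_isLow h1, single_isLow h2, single_isLow h3⟩
  · obtain ⟨hm, h1, h2, h3⟩ := three_singles (m := m) (i := i) (j := j) (l := o) hn (fun e => hab (by rw [e]))
      (fun e => had (by rw [e])) (fun e => hbd (by rw [e])) (by
        linear_combination h - (Pi.single i 1 + Pi.single j 1 : Fin n → Bool) * two_eq_zero)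
    subst hm
    exact ⟨rfl, single_isLow h1, single_isLow h2, onesPrefix_three_isLow⟩
  · obtain ⟨hm, h1, h2, h3⟩ := three_singles (m := m) (i := i) (j := l) (l := o) hn (fun e => hac (by rw [e]))
      (fun e => had (by rw [e])) (fun e => hcd (by rw [e])) (by
        linear_combination h - (Pi.single i 1 + Pi.single l 1 : Fin n → Bool) * two_eq_zero)
    subst hm
    exact ⟨rfl, single_isLow h1, onesPrefix_three_isLow, single_isLow h2⟩
  · obtain ⟨hm, h1, h2, h3⟩ := three_singles (m := m) (i := j) (j := l) (l := o) hn (fun e => hbc (by rw [e]))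
      (fun e => hbd (by rw [e])) (fun e => hcd (by rw [e])) (by
        linear_combination h - (Pi.single j 1 + Pi.single l 1 : Fin n → Bool) * two_eq_zero)
    subst hm
    exact ⟨rfl, onesPrefix_three_isLow, single_isLow h1, single_isLow h2⟩

/-! ### Displacements, and the case of a prefix length other than three -/

/-- A function unchanged by flipping any coordinate outside `T` depends only on the coordinates
in `T`. -/
theorem eq_of_eqOn {n : ℕ} {α : Type*} {f : (Fin n → Bool) → α} {T : Fin n → Prop}
    (hf : ∀ i, ¬ T i → ∀ x, f (x + Pi.single i 1) = f x) {x y : Fin n → Bool}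
    (hxy : ∀ i, T i → x i = y i) : f x = f y := by
  have key : ∀ s : Finset (Fin n), (∀ i ∈ s, ¬ T i) →
      f (x + ∑ i ∈ s, Pi.single i 1) = f x := by
    intro s
    induction s using Finset.induction_on with
    | empty => simp
    | insert i s hi ih =>
      intro hs
      rw [Finset.sum_insert hi, add_comm (Pi.single i 1), ← add_assoc,
        hf i (hs i (Finset.mem_insert_self _ _)),
        ih fun j hj => hs j (Finset.mem_insert_of_mem hj)]
  rw [← key (Finset.univ.filter fun i => x i ≠ y i) fun i hi hT =>
    (Finset.mem_filter.mp hi).2 (hxy i hT)]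
  congr 1
  have : ∑ i ∈ Finset.univ.filter (fun i => x i ≠ y i), (Pi.single i 1 : Fin n → Bool) =
      x + y := by
    rw [Finset.sum_filter, ← Finset.univ_sum_single (x + y)]
    refine Finset.sum_congr rfl fun i _ => ?_
    rw [Pi.add_apply]
    cases x i <;> cases y i <;> simp [bool_add] <;> first | rfl | exact (Pi.single_zero i).symm
  rw [this]
  linear_combination x * two_eq_zero

theorem niceInvolutions_iff {n k : ℕ} (hk : k < n) {φ : (Fin n → Bool) → Fin n → Bool} :
    φ ∈ niceInvolutions (enhancedHypercube n k) ↔ Function.Involutive φ ∧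
      (∀ x, x + φ x ∈ directions n (n - k)) ∧
      ∀ x y, x + y ∈ directions n (n - k) → φ x + φ y ∈ directions n (n - k) := by
  simp only [niceInvolutions, Set.mem_ofPred_eq, enhancedHypercube_adj hk]

/-- The fourth direction is `φ x + φ (x + g)`. If either displacement is `g`, then `φ` matches `x`
with `x + g` and both displacements agree; the other coincidences reduce to these or to equal
displacements. -/
theorem displacement_eq_or {n k : ℕ} (hk : k < n) {φ : (Fin n → Bool) → Fin n → Bool}
    (hφ : φ ∈ niceInvolutions (enhancedHypercube n k)) {x g : Fin n → Bool}
    (hg : g ∈ directions n (n - k)) :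
    x + g + φ (x + g) = x + φ x ∨
      n - k = 3 ∧ IsLow (x + φ x) ∧ IsLow (x + g + φ (x + g)) ∧ IsLow g := by
  obtain ⟨hinv, hadj, hpres⟩ := (niceInvolutions_iff hk).mp hφ
  by_cases heq : x + g + φ (x + g) = x + φ x
  · exact Or.inl heq
  right
  have hsum := hpres x (x + g) (by
    rwa [show x + (x + g) = g by linear_combination x * two_eq_zero])
  have hag : x + φ x ≠ g := by
    intro h
    have h1 : φ x = x + g := by linear_combination h - x * two_eq_zero
    have h2 : φ (x + g) = x := by rw [← h1, hinv]
    exact heq (by rw [h1, h2]; ring)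
  have hbg : x + g + φ (x + g) ≠ g := by
    intro h
    have h1 : φ (x + g) = x := by linear_combination h - x * two_eq_zero
    have h2 : φ x = x + g := by rw [← h1, hinv, h1]
    exact heq (by rw [h1, h2]; ring)
  refine four_directions (by omega) (hadj x) (hadj (x + g)) hg hsum (Ne.symm heq) hag ?_ hbg ?_ ?_
    ?_
  · intro h
    exact hbg (by linear_combination -h + (x + g) * two_eq_zero - g * two_eq_zero)
  · intro h
    exact hag (by linear_combination -h + (x) * two_eq_zero)
  · intro h
    refine heq ?_
    linear_combination -h + (g - φ x) * two_eq_zero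
  · linear_combination (x + g) * two_eq_zero

theorem translation_mem {n k : ℕ} (hk : k < n) {d : Fin n → Bool}
    (hd : d ∈ directions n (n - k)) :
    (fun x => x + d) ∈ niceInvolutions (enhancedHypercube n k) := by
  rw [niceInvolutions_iff hk]
  refine ⟨fun x => ?_, fun x => ?_, fun x y h => ?_⟩
  · linear_combination d * two_eq_zero
  · rwa [show x + (x + d) = d by linear_combination x * two_eq_zero]
  · rwa [show x + d + (y + d) = x + y by linear_combination d * two_eq_zero]

theorem translation_injective {n : ℕ} :
    Function.Injective fun d : Fin n → Bool => fun x => x + d := by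
  intro d d' h
  simpa using congrFun h 0

theorem numNice_of_ne_three {n k : ℕ} (hk : k < n) (h3 : n - k ≠ 3) :
    numNice (enhancedHypercube n k) = (directions n (n - k)).ncard := by
  rw [numNice_eq, ← Set.ncard_image_of_injective _ translation_injective]
  congr 1
  ext φ
  constructor
  · intro hφ
    refine ⟨0 + φ 0, ((niceInvolutions_iff hk).mp hφ).2.1 0, ?_⟩
    funext x
    have := eq_of_eqOn (f := fun x => x + φ x) (T := fun _ => False) (x := x) (y := 0)
      (fun i _ x => (displacement_eq_or hk hφ (Or.inl ⟨i, rfl⟩)).resolve_right fun h => h3 h.1)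
      (fun i => False.elim)
    change x + φ x = 0 + φ 0 at this
    linear_combination -this + x * two_eq_zero
  · rintro ⟨d, hd, rfl⟩
    exact translation_mem hk hd


/-! ### Prefix length three -/

/-- Involutions exchanging two complementary sets correspond to bijections between them. -/
theorem ncard_swaps {α : Type*} [Fintype α] [DecidableEq α] {p : α → Prop} [DecidablePred p]
    (e₀ : {x // p x} ≃ {x // ¬ p x}) :
    {ψ : α → α | Function.Involutive ψ ∧ ∀ x, p (ψ x) ↔ ¬ p x}.ncard =
      (Fintype.card {x // p x}).factorial := by
  let F : ({x // p x} ≃ {x // ¬ p x}) → α → α := fun e x =>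
    if h : p x then e ⟨x, h⟩ else e.symm ⟨x, h⟩
  have hF : Function.Injective F := by
    intro e e' h
    ext ⟨x, hx⟩
    simpa [F, hx] using congrFun h x
  have hrange : {ψ : α → α | Function.Involutive ψ ∧ ∀ x, p (ψ x) ↔ ¬ p x} = Set.range F := by
    ext ψ
    constructor
    · rintro ⟨hψ, hp⟩
      refine ⟨⟨fun x => ⟨ψ x, fun h => (hp x).mp h x.2⟩, fun x => ⟨ψ x, (hp x).mpr x.2⟩,
        fun x => Subtype.ext (hψ x), fun x => Subtype.ext (hψ x)⟩, ?_⟩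
      funext x
      by_cases h : p x <;> simp [F, h]
    · rintro ⟨e, rfl⟩
      refine ⟨fun x => ?_, fun x => ?_⟩
      · by_cases h : p x
        · have := (e ⟨x, h⟩).2
          simp [F, h, this]
        · have := (e.symm ⟨x, h⟩).2
          simp [F, h, this]
      · by_cases h : p x
        · simpa [F, h] using (e ⟨x, h⟩).2
        · simpa [F, h] using (e.symm ⟨x, h⟩).2
  rw [hrange, ← Nat.card_coe_set_eq, Nat.card_range_of_injective hF, Nat.card_eq_fintype_card,
    Fintype.card_equiv e₀]

/-- The sum of the terms of a sequence of length three. -/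
def parity (w : Fin 3 → Bool) : Bool := w 0 + w 1 + w 2

theorem parity_add (v w : Fin 3 → Bool) : parity (v + w) = parity v + parity w := by
  simp only [parity, Pi.add_apply]
  ring

/-- The involutions of the sequences of length three that change the parity. -/
def paritySwaps : Set ((Fin 3 → Bool) → Fin 3 → Bool) :=
  {ψ | Function.Involutive ψ ∧ ∀ x, parity (ψ x) = 1 ↔ ¬ parity x = 1}

theorem ncard_paritySwaps : paritySwaps.ncard = 24 := by
  have e : Fintype.card {x : Fin 3 → Bool // parity x = 1} = 4 := by decide
  rw [paritySwaps, ncard_swaps (p := fun x => parity x = 1) (Fintype.equivOfCardEq (by decide)), e]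
  rfl

/-- The first three terms of a sequence. -/
def head {n : ℕ} (hn : 3 ≤ n) (x : Fin n → Bool) : Fin 3 → Bool := fun i => x (Fin.castLE hn i)

/-- The sequence `x` with its first three terms replaced by `w`. -/
def glue {n : ℕ} (w : Fin 3 → Bool) (x : Fin n → Bool) : Fin n → Bool := fun t =>
  if h : (t : ℕ) < 3 then w ⟨t, h⟩ else x t

theorem head_glue {n : ℕ} (hn : 3 ≤ n) (w : Fin 3 → Bool) (x : Fin n → Bool) :
    head hn (glue w x) = w := by
  funext i
  simp [head, glue]

theorem glue_eq_iff {n : ℕ} (hn : 3 ≤ n) {w : Fin 3 → Bool} {x y : Fin n → Bool} :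
    glue w x = y ↔ IsLow (x + y) ∧ head hn y = w := by
  constructor
  · rintro rfl
    refine ⟨fun t ht => ?_, head_glue hn w x⟩
    rw [Pi.add_apply, glue, dif_neg (by omega)]
    exact Bool.xor_self _
  · rintro ⟨h, rfl⟩
    funext t
    by_cases ht : (t : ℕ) < 3
    · simp [glue, ht, head, Fin.castLE]
    · rw [glue, dif_neg ht]
      have := h t (by omega)
      rw [Pi.add_apply] at this
      revert this
      generalize x t = a
      generalize y t = b
      revert a b
      decide

theorem head_add {n : ℕ} (hn : 3 ≤ n) (x y : Fin n → Bool) :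
    head hn (x + y) = head hn x + head hn y := rfl

/-- The odd-weight vectors of length three are exactly the three unit vectors and `111`. -/
theorem mem_directions_three {n : ℕ} (hn : 3 ≤ n) {v : Fin n → Bool} (hv : IsLow v) :
    v ∈ directions n 3 ↔ parity (head hn v) = 1 := by
  have hodd : ∀ w : Fin 3 → Bool, parity w = 1 ↔ (∃ i, Pi.single i 1 = w) ∨ w = 1 := by
    decide
  have hlow : ∀ {u : Fin n → Bool}, IsLow u → (u = v ↔ head hn u = head hn v) := by
    intro u hu
    refine ⟨fun h => h ▸ rfl, fun h => ?_⟩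
    have h0 : glue (head hn v) 0 = u := (glue_eq_iff hn).mpr ⟨by rwa [zero_add], h⟩
    have h1 : glue (head hn v) 0 = v := (glue_eq_iff hn).mpr ⟨by rwa [zero_add], rfl⟩
    rw [← h0, h1]
  have hs : ∀ i : Fin 3, head hn (Pi.single (Fin.castLE hn i) 1) = Pi.single i 1 := by
    intro i
    funext j
    simp [head, Pi.single_apply, Fin.ext_iff]
  have ho : head hn (onesPrefix n 3) = 1 := by
    funext j
    simp [head, onesPrefix]
    rfl
  rw [hodd, directions, Set.mem_union, Set.mem_singleton_iff, eq_comm (a := v),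
    hlow onesPrefix_three_isLow, ho, eq_comm (a := (1 : Fin 3 → Bool))]
  refine or_congr_left ⟨?_, ?_⟩
  · rintro ⟨i, rfl⟩
    have hi : (i : ℕ) < 3 := by
      by_contra h
      have := hv i (by omega)
      simp at this
    exact ⟨⟨i, hi⟩, (hs ⟨i, hi⟩).symm⟩
  · rintro ⟨i, hi⟩
    refine ⟨Fin.castLE hn i, ?_⟩
    have := (hlow (single_isLow (i := Fin.castLE hn i) (by simp))).mpr (by rw [hs, hi])
    exact this

theorem eq_single_of_not_isLow {n : ℕ} {v : Fin n → Bool} (hv : v ∈ directions n 3)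
    (h : ¬ IsLow v) : ∃ i : Fin n, 3 ≤ (i : ℕ) ∧ Pi.single i 1 = v := by
  rcases hv with ⟨i, rfl⟩ | rfl
  · exact ⟨i, by by_contra hi; exact h (single_isLow (by omega)), rfl⟩
  · exact absurd onesPrefix_three_isLow h

/-- The involution of the sequences of length `n` acting by `ψ` on the first three terms. -/
def liftSwap {n : ℕ} (hn : 3 ≤ n) (ψ : (Fin 3 → Bool) → Fin 3 → Bool) (x : Fin n → Bool) :
    Fin n → Bool := glue (ψ (head hn x)) x

theorem liftSwap_injective {n : ℕ} (hn : 3 ≤ n) : Function.Injective (liftSwap hn) := by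
  intro ψ ψ' h
  funext w
  have := congrArg (head hn) (congrFun h (glue w 0))
  simpa only [liftSwap, head_glue] using this

theorem head_liftSwap {n : ℕ} (hn : 3 ≤ n) (ψ : (Fin 3 → Bool) → Fin 3 → Bool)
    (x : Fin n → Bool) : head hn (liftSwap hn ψ x) = ψ (head hn x) := head_glue _ _ _

theorem isLow_add_liftSwap {n : ℕ} (hn : 3 ≤ n) (ψ : (Fin 3 → Bool) → Fin 3 → Bool)
    (x : Fin n → Bool) : IsLow (x + liftSwap hn ψ x) := ((glue_eq_iff hn).mp rfl).1

theorem IsLow.add {n : ℕ} {v w : Fin n → Bool} (hv : IsLow v) (hw : IsLow w) :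
    IsLow (v + w) := by
  intro t ht
  rw [Pi.add_apply, hv t ht, hw t ht]
  rfl

/-- Low directions are the odd ones, so reversing parity on both ends of a low edge keeps their sum
odd. Along a higher direction the heads agree, so both ends undergo the same change. -/
theorem liftSwap_mem {n k : ℕ} (hn : 3 ≤ n) (hk : n - k = 3)
    {ψ : (Fin 3 → Bool) → Fin 3 → Bool} (hψ : ψ ∈ paritySwaps) :
    liftSwap hn ψ ∈ niceInvolutions (enhancedHypercube n k) := by
  obtain ⟨hinv, hpar⟩ := hψ
  rw [niceInvolutions_iff (by omega), hk]
  have hpar' : ∀ w, parity (ψ w) = parity w + 1 := by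
    intro w
    have := hpar w
    revert this
    generalize parity (ψ w) = a
    generalize parity w = b
    revert a b
    decide
  refine ⟨fun x => ?_, fun x => ?_, fun x y hxy => ?_⟩
  · refine (glue_eq_iff hn).mpr ⟨?_, ?_⟩
    · rw [add_comm]
      exact isLow_add_liftSwap hn ψ x
    · rw [head_liftSwap, hinv]
  · rw [mem_directions_three hn (isLow_add_liftSwap hn ψ x), head_add, head_liftSwap, parity_add,
      hpar']
    generalize parity (head hn x) = a
    revert a
    decide
  · have hsum : liftSwap hn ψ x + liftSwap hn ψ y =
        x + liftSwap hn ψ x + (y + liftSwap hn ψ y) + (x + y) := by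
      linear_combination -(x + y) * two_eq_zero
    by_cases hlow : IsLow (x + y)
    · rw [mem_directions_three hn hlow, head_add, parity_add] at hxy
      rw [mem_directions_three hn, head_add, parity_add, head_liftSwap, head_liftSwap, hpar',
        hpar', ← hxy]
      · generalize parity (head hn x) = a
        generalize parity (head hn y) = b
        revert a b
        decide
      · rw [hsum]
        exact ((isLow_add_liftSwap hn ψ x).add (isLow_add_liftSwap hn ψ y)).add hlow
    · obtain ⟨i, hi, hxi⟩ := eq_single_of_not_isLow hxy hlow
      have hhead : head hn x = head hn y := by
        rw [← add_eq_zero_iff, ← head_add, ← hxi]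
        funext j
        exact Pi.single_eq_of_ne (by rintro rfl; simp at hi; omega) _
      have : liftSwap hn ψ x + liftSwap hn ψ y = x + y := by
        funext t
        simp only [liftSwap, Pi.add_apply, glue, hhead]
        split_ifs with ht
        · rw [← Pi.add_apply x y, ← hxi, Pi.single_eq_of_ne (by rintro rfl; omega)]
          exact Bool.xor_self _
        · rfl
      rwa [this]

/-- If all displacements are low, they depend only on the first three coordinates, and `φ` is a
lift. If one is not low, it is a higher unit vector and propagates to every vertex. -/
theorem niceInvolutions_three {n k : ℕ} (hn : 3 ≤ n) (hk : n - k = 3) :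
    niceInvolutions (enhancedHypercube n k) = liftSwap hn '' paritySwaps ∪
      Set.range fun i : {i : Fin n // 3 ≤ (i : ℕ)} => fun x => x + Pi.single i.1 1 := by
  classical
  have hkn : k < n := by omega
  apply Set.Subset.antisymm
  · intro φ hφ
    obtain ⟨hinv, hadj, -⟩ := (niceInvolutions_iff hkn).mp hφ
    rw [hk] at hadj
    by_cases hall : ∀ x, IsLow (x + φ x)
    · left
      have hdep : ∀ x y : Fin n → Bool, head hn x = head hn y → x + φ x = y + φ y := by
        intro x y hxy
        refine eq_of_eqOn (f := fun x => x + φ x) (T := fun i => (i : ℕ) < 3) ?_ ?_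
        · intro i hi x
          refine (displacement_eq_or hkn hφ (Or.inl ⟨i, rfl⟩)).resolve_right fun h => ?_
          have := h.2.2.2 i (by omega)
          simp at this
        · intro i hi
          exact congrFun hxy ⟨i, hi⟩
      have hlift : liftSwap hn (fun w => head hn (φ (glue w 0))) = φ := by
        funext x
        refine (glue_eq_iff hn).mpr ⟨hall x, ?_⟩
        have h := congrArg (head hn) (hdep x (glue (head hn x) 0) (head_glue _ _ _).symm)
        rw [head_add, head_add, head_glue] at h
        exact add_left_cancel h
      refine ⟨_, ⟨fun w => ?_, fun w => ?_⟩, hlift⟩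
      · have h := congrArg (head hn) (hinv (glue w 0))
        rw [← hlift, head_liftSwap, head_liftSwap, head_glue] at h
        exact h
      · have h := (mem_directions_three hn (hall _)).mp (hadj (glue w 0))
        rw [head_add, head_glue, parity_add] at h
        revert h
        generalize parity (head hn (φ (glue w 0))) = a
        generalize parity w = b
        revert a b
        decide
    · right
      push Not at hall
      obtain ⟨x, hx⟩ := hall
      obtain ⟨i, hi, hxi⟩ := eq_single_of_not_isLow (hadj x) hx
      refine ⟨⟨i, hi⟩, ?_⟩
      funext y
      -- Low displacements are collapsed to `0`, so this function is unchanged by every coordinate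
      -- flip even in the exceptional case, and is therefore constant.
      have h := eq_of_eqOn (f := fun x => if IsLow (x + φ x) then 0 else x + φ x)
        (T := fun _ => False) (x := y) (y := x) (by
          intro j _ z
          rcases displacement_eq_or hkn hφ (x := z) (Or.inl ⟨j, rfl⟩) with h | h
          · simp only [h]
          · simp only [h.2.1, h.2.2.1, if_true]) (fun i => False.elim)
      simp only [hx, if_false] at h
      by_cases hy : IsLow (y + φ y)
      · rw [if_pos hy, ← hxi] at h
        have := congrFun h i
        simp at this
      · rw [if_neg hy, ← hxi] at h
        change y + Pi.single i 1 = φ y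
        linear_combination -h + y * two_eq_zero
  · apply Set.union_subset
    · rintro _ ⟨ψ, hψ, rfl⟩
      exact liftSwap_mem hn hk hψ
    · rintro _ ⟨i, rfl⟩
      exact translation_mem hkn (Or.inl ⟨i, rfl⟩)

theorem numNice_three {n k : ℕ} (hn : 3 ≤ n) (hk : n - k = 3) :
    numNice (enhancedHypercube n k) = n + 21 := by
  rw [numNice_eq, niceInvolutions_three hn hk, Set.ncard_union_eq,
    Set.ncard_image_of_injective _ (liftSwap_injective hn), ncard_paritySwaps,
    ← Nat.card_coe_set_eq, Nat.card_range_of_injective, Nat.card_eq_fintype_card,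
    Fintype.card_congr (β := Fin (n - 3))
      ⟨fun t => ⟨t.1 - 3, by omega⟩, fun s => ⟨⟨s + 3, by omega⟩, by simp⟩,
        fun t => Subtype.ext (Fin.ext (Nat.sub_add_cancel t.2)), fun s => Fin.ext (Nat.add_sub_cancel (n := s) (m := 3))⟩,
    Fintype.card_fin]
  -- Here `24 + (n - 3) = n + 21`.
  · omega
  · intro i j h
    exact Subtype.ext (single_injective (translation_injective h))
  · rw [Set.disjoint_left]
    rintro _ ⟨ψ, -, rfl⟩ ⟨i, h⟩
    have h0 := isLow_add_liftSwap hn ψ 0 i.1 i.2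
    rw [← h] at h0
    simp at h0

end NiceMatching

theorem mainTheorem9 :
    (∀ n : ℕ, 1 ≤ n →
      NiceMatching.numNice (NiceMatching.enhancedHypercube n (n - 1)) = n) ∧
    (∀ n : ℕ, 2 ≤ n →
      NiceMatching.numNice (NiceMatching.enhancedHypercube n (n - 2)) = n + 1) ∧
    (∀ n : ℕ, 3 ≤ n →
      NiceMatching.numNice (NiceMatching.enhancedHypercube n (n - 3)) = n + 21) ∧
    (∀ n k : ℕ, 4 ≤ n → k ≤ n - 4 →
      NiceMatching.numNice (NiceMatching.enhancedHypercube n k) = n + 1) := by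
  refine ⟨fun n hn => ?_, fun n hn => ?_, fun n hn => ?_, fun n k hn hk => ?_⟩
  · rw [NiceMatching.numNice_of_ne_three (by omega) (by omega), show n - (n - 1) = 1 by omega,
      NiceMatching.ncard_directions_one hn]
  · rw [NiceMatching.numNice_of_ne_three (by omega) (by omega),
      NiceMatching.ncard_directions (by omega) (by omega)]
  · exact NiceMatching.numNice_three hn (by omega)
  · rw [NiceMatching.numNice_of_ne_three (by omega) (by omega),
      NiceMatching.ncard_directions (by omega) (by omega)]
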